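/- Let $m\ge 1$ and let $E(m)\le O(2^m,\mathbb{R})$ be the group generated by all matrices $I_2\otimes\cdots\otimes\sigma\otimes\cdots\otimes I_2$ ($m$ tensor factors, $\sigma$ in any position), where $\sigma$ is $\sigma_1=\begin{pmatrix}0&1\\1&0\end{pmatrix}$ or $\sigma_2=\begin{pmatrix}1&0\\0&-1\end{pmatrix}$. Let the real Clifford group $\mathcal{C}_m$ be the normalizer of $E(m)$ in $O(2^m,\mathbb{R})$. The rows and columns of these matrices are indexed by $\mathbb{F}_2^{\,m}$, which is identified with $\mathbb{F}_{2^m}$ by means of a fixed basis of $\mathbb{F}_{2^m}$ over $\mathbb{F}_2$ (any basis may be chosen); $g\in\mathcal{C}_m$ acts on $\mathbb{R}[x_f\mid f\in\mathbb{F}_{2^m}]$ as the algebra automorphism with $g\cdot x_f=\sum_{f'}g_{f',f}\,x_{f'}$. For a binary linear code $C\le\mathbb{F}_2^N$ let $C(m):=C\otimes_{\mathbb{F}_2}\mathbb{F}_{2^m}\le\mathbb{F}_{2^m}^N$ and $$\operatorname{cwe}(C(m)):=\sum_{c\in C(m)}\ \prod_{f\in\mathbb{F}_{2^m}}x_f^{a_f(c)},$$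 where $a_f(c)$ is the number of components of $c$ that are equal to $f$. Theorem. The group $\mathcal{C}_m$ is finite, and for every binary self-orthogonal code $C$ of even length $N$ that contains the all-ones vector $\mathbf{1}$ and has dimension $N/2-r$, $$\frac{1}{|\mathcal{C}_m|}\sum_{g\in\mathcal{C}_m}g\cdot\operatorname{cwe}(C(m))=\prod_{1\le i\le r}(2^m+2^i)^{-1}\ \sum_{C'}\operatorname{cwe}(C'(m)),$$ where the sum on the right is over all self-dual codes $C'\le\mathbb{F}_2^N$ containing $C$. -/

import Mathlib

open scoped BigOperators

noncomputable section

namespace CliffordAverage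

/-! ### The real Clifford group -/

/-- The matrix `σ₁`, exchanging the two basis vectors `y₀, y₁` of `ℝ² = ℝ[𝔽₂]`. -/
def sigmaOne : Matrix (ZMod 2) (ZMod 2) ℝ :=
  Matrix.of fun a b => if a = b then 0 else 1

/-- The matrix `σ₂ = diag (1, -1)` on `ℝ² = ℝ[𝔽₂]`. -/
def sigmaTwo : Matrix (ZMod 2) (ZMod 2) ℝ :=
  Matrix.diagonal fun a => if a = 0 then 1 else -1

/-- The Kronecker product `A₁ ⊗ ⋯ ⊗ Aₘ` of `m` real `2 × 2` matrices, acting on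
`⊗ᵐ ℝ² = ℝ[𝔽₂ᵐ]`; its rows and columns are indexed by `𝔽₂ᵐ`. -/
def tensorMatrix {m : ℕ} (A : Fin m → Matrix (ZMod 2) (ZMod 2) ℝ) :
    Matrix (Fin m → ZMod 2) (Fin m → ZMod 2) ℝ :=
  Matrix.of fun v w => ∏ i, A i (v i) (w i)

/-- The matrix `I₂ ⊗ ⋯ ⊗ A ⊗ ⋯ ⊗ I₂` with `A` in position `i`. -/
def tensorAt {m : ℕ} (i : Fin m) (A : Matrix (ZMod 2) (ZMod 2) ℝ) :
    Matrix (Fin m → ZMod 2) (Fin m → ZMod 2) ℝ :=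
  tensorMatrix (Function.update (fun _ => 1) i A)

/-- The extraspecial group `E(m) = E(1)^{⊗ m}` inside `O(2ᵐ, ℝ)`, generated by all tensor
products of one copy of `σ₁` or `σ₂` with `2 × 2` identity matrices. -/
def extraspecialGroup (m : ℕ) : Subgroup (Matrix.orthogonalGroup (Fin m → ZMod 2) ℝ) :=
  Subgroup.closure
    {g | ∃ i : Fin m,
      (g : Matrix (Fin m → ZMod 2) (Fin m → ZMod 2) ℝ) = tensorAt i sigmaOne ∨
      (g : Matrix (Fin m → ZMod 2) (Fin m → ZMod 2) ℝ) = tensorAt i sigmaTwo}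

/-- The real Clifford group of genus `m`: the normalizer of `E(m)` in `O(2ᵐ, ℝ)`. -/
def cliffordGroup (m : ℕ) : Subgroup (Matrix.orthogonalGroup (Fin m → ZMod 2) ℝ) :=
  Subgroup.normalizer (extraspecialGroup m : Set (Matrix.orthogonalGroup (Fin m → ZMod 2) ℝ))

/-- The action of a matrix `g`, indexed by `𝔽₂ᵐ`, on `ℝ[x_f | f ∈ F]`, where `F` is identified
with `𝔽₂ᵐ` by the basis `b`: the algebra endomorphism `x_f ↦ ∑_{f'} g_{f', f} x_{f'}`, which is
the action on the symmetric powers of `ℝ[F] = ⨁_f ℝ x_f` induced by the linear one. -/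
def polyAction {m : ℕ} {F : Type*} [Field F] [Fintype F] [Algebra (ZMod 2) F]
    (b : Module.Basis (Fin m) (ZMod 2) F)
    (g : Matrix (Fin m → ZMod 2) (Fin m → ZMod 2) ℝ) :
    MvPolynomial F ℝ →ₐ[ℝ] MvPolynomial F ℝ :=
  MvPolynomial.aeval fun f =>
    ∑ f' : F, g (b.equivFun f') (b.equivFun f) • (MvPolynomial.X f' : MvPolynomial F ℝ)

/-! ### Codes and complete weight enumerators -/

/-- A binary linear code of length `N`: a subspace of `𝔽₂ᴺ`. -/
abbrev BinaryCode (N : ℕ) := Submodule (ZMod 2) (Fin N → ZMod 2)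

/-- The dual code `C^⊥` with respect to the standard dot product. -/
def dualCode {N : ℕ} (C : BinaryCode N) : BinaryCode N where
  carrier := {v | ∀ c ∈ C, c ⬝ᵥ v = 0}
  add_mem' := by
    intro v w hv hw c hc
    rw [dotProduct_add, hv c hc, hw c hc, add_zero]
  zero_mem' := by
    intro c _
    exact dotProduct_zero c
  smul_mem' := by
    intro a v hv c hc
    rw [dotProduct_smul, hv c hc, smul_zero]

def IsSelfOrthogonal {N : ℕ} (C : BinaryCode N) : Prop := C ≤ dualCode C

def IsSelfDual {N : ℕ} (C : BinaryCode N) : Prop := C = dualCode C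

/-- The extension of scalars `C ⊗_{𝔽₂} F` of a binary code, as a code in `Fᴺ`: the `F`-span of
the codewords of `C`. -/
def extendCode {N : ℕ} (F : Type*) [Field F] [Algebra (ZMod 2) F] (C : BinaryCode N) :
    Submodule F (Fin N → F) :=
  Submodule.span F ((fun c i => algebraMap (ZMod 2) F (c i)) '' (C : Set (Fin N → ZMod 2)))

open Classical in
/-- The complete weight enumerator `∑_{c ∈ D} ∏_{f ∈ F} x_f ^ {a_f(c)}` of a code `D ≤ Fᴺ`,
where `a_f(c)` is the number of components of `c` equal to `f`. -/
def cwe {N : ℕ} {F : Type*} [Field F] [Fintype F] (D : Submodule F (Fin N → F)) :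
    MvPolynomial F ℝ :=
  ∑ c : Fin N → F with c ∈ D,
    ∏ f : F, MvPolynomial.X f ^ (Finset.univ.filter fun i => c i = f).card

end CliffordAverage

end

open scoped BigOperators

noncomputable section

namespace CliffordAverage

/-! A code C is encoded by the indicator tensor of C^m in the N-th tensor power of ℝ^(𝔽₂^m). Its
weight enumerator is the image of this tensor in the symmetric power, so the identity is proved for
tensors (`average_codeTensor`) and then pushed forward.

If C is self-dual, its tensor is, up to a scalar, the only one fixed by every e in E(m) acting on
the factors in the support of a codeword (`eq_smul_codeTensor`). The Clifford group permutes these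
conditions, so each g scales the tensor. The scalar is 1 because the tensor has positive inner
product with the indicator of the words (u, u), which every orthogonal matrix fixes.

For general C, reflections (X_a + Z_b)/√2 with b·a = 1 suffice, where X_a is a shift and Z_b a sign
matrix. The N-th tensor power of such a reflection sends the tensor of C to 2^(-N/2) times the sum
over x in C^⊥ of its translates by x ⊗ a (`tensorPow_hadamard_mulVec_codeTensor`). The average
absorbs the reflection, and summing over a ≠ 0 assembles the translates into tensors of the codes C
+ ⟨x⟩. This recursion (`average_codeTensor_recursion`) and induction on r express the average
through the self-dual codes above C; counting codewords yields the new factor (2^m + 2^r)⁻¹. -/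

/-! ### The sign character of `𝔽₂` -/

/-- The nontrivial additive character `x ↦ (-1)ˣ` of `𝔽₂`. -/
def parity (x : ZMod 2) : ℝ := if x = 0 then 1 else -1

@[simp] lemma parity_zero : parity 0 = 1 := by simp [parity]

@[simp] lemma parity_one : parity 1 = -1 := by simp [parity]

lemma zmod_two_cases (x : ZMod 2) : x = 0 ∨ x = 1 := by
  revert x; decide

lemma parity_add (x y : ZMod 2) : parity (x + y) = parity x * parity y := by
  have h : (1 : ZMod 2) + 1 = 0 := by decide
  rcases zmod_two_cases x with rfl | rfl <;> rcases zmod_two_cases y with rfl | rfl <;>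
    simp [h]

lemma parity_mul_self (x : ZMod 2) : parity x * parity x = 1 := by
  rw [← parity_add, CharTwo.add_self_eq_zero, parity_zero]

lemma parity_sum {ι : Type*} (s : Finset ι) (f : ι → ZMod 2) :
    parity (∑ i ∈ s, f i) = ∏ i ∈ s, parity (f i) := by
  classical
  induction s using Finset.induction_on with
  | empty => simp
  | insert a s ha ih => rw [Finset.sum_insert ha, Finset.prod_insert ha, parity_add, ih]

/-! ### Shift and sign matrices -/

section ShiftSign

variable {m : ℕ}

/-- The permutation matrix of the translation by `a` on `𝔽₂ᵐ`. -/
def shiftMat (a : Fin m → ZMod 2) : Matrix (Fin m → ZMod 2) (Fin m → ZMod 2) ℝ :=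
  Matrix.of fun w v => if v = w + a then 1 else 0

/-- The diagonal matrix with entries `(-1)^{b·v}`. -/
def signMat (b : Fin m → ZMod 2) : Matrix (Fin m → ZMod 2) (Fin m → ZMod 2) ℝ :=
  Matrix.diagonal fun v => parity (b ⬝ᵥ v)

lemma shiftMat_zero : shiftMat (0 : Fin m → ZMod 2) = 1 := by
  ext w v
  simp [shiftMat, Matrix.one_apply, eq_comm]

lemma signMat_zero : signMat (0 : Fin m → ZMod 2) = 1 := by
  simp [signMat]

lemma shiftMat_mul_apply (a : Fin m → ZMod 2)
    (A : Matrix (Fin m → ZMod 2) (Fin m → ZMod 2) ℝ) (w v : Fin m → ZMod 2) :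
    (shiftMat a * A) w v = A (w + a) v := by
  simp [shiftMat, Matrix.mul_apply]

lemma add_self_eq_zero_of_module {G : Type*} [AddCommGroup G] [Module (ZMod 2) G] (a : G) :
    a + a = 0 := by
  have : (1 + 1 : ZMod 2) • a = 0 := by
    rw [show (1 + 1 : ZMod 2) = 0 by decide, zero_smul]
  rwa [add_smul, one_smul] at this

lemma eq_add_iff_add_eq {G : Type*} [AddCommGroup G] [Module (ZMod 2) G] (v w a : G) :
    v = w + a ↔ w = v + a := by
  constructor <;> rintro rfl <;> rw [add_assoc, add_self_eq_zero_of_module, add_zero]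

lemma mul_shiftMat_apply (a : Fin m → ZMod 2)
    (A : Matrix (Fin m → ZMod 2) (Fin m → ZMod 2) ℝ) (w v : Fin m → ZMod 2) :
    (A * shiftMat a) w v = A w (v + a) := by
  simp [shiftMat, Matrix.mul_apply, eq_add_iff_add_eq v]

lemma shiftMat_mul_shiftMat (a b : Fin m → ZMod 2) :
    shiftMat a * shiftMat b = shiftMat (a + b) := by
  ext w v
  rw [shiftMat_mul_apply]
  simp [shiftMat, add_assoc]

lemma signMat_mul_signMat (a b : Fin m → ZMod 2) :
    signMat a * signMat b = signMat (a + b) := by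
  simp [signMat, add_dotProduct, parity_add]

lemma signMat_mul_shiftMat (a b : Fin m → ZMod 2) :
    signMat b * shiftMat a = parity (b ⬝ᵥ a) • (shiftMat a * signMat b) := by
  ext w v
  rw [mul_shiftMat_apply, Matrix.smul_apply, shiftMat_mul_apply]
  by_cases h : w = v + a
  · subst h
    rw [add_assoc, add_self_eq_zero_of_module, add_zero]
    simp [signMat, dotProduct_add, parity_add, mul_comm]
  · have h' : w + a ≠ v := fun h' => h ((eq_add_iff_add_eq v w a).1 h'.symm)
    simp [signMat, h, h']

lemma shiftMat_mul_signMat (a b : Fin m → ZMod 2) :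
    shiftMat a * signMat b = parity (b ⬝ᵥ a) • (signMat b * shiftMat a) := by
  rw [signMat_mul_shiftMat, smul_smul, parity_mul_self, one_smul]

lemma shiftMat_transpose (a : Fin m → ZMod 2) : (shiftMat a).transpose = shiftMat a := by
  ext w v
  simp [shiftMat, eq_add_iff_add_eq v]

lemma signMat_transpose (b : Fin m → ZMod 2) : (signMat b).transpose = signMat b :=
  Matrix.diagonal_transpose _

lemma mem_orthogonalGroup_of_symm {n : Type*} [Fintype n] [DecidableEq n] {A : Matrix n n ℝ}
    (hs : A.transpose = A) (hA : A * A = 1) : A ∈ Matrix.orthogonalGroup n ℝ := by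
  rw [Matrix.mem_orthogonalGroup_iff, hs, hA]

lemma shiftMat_mul_self (a : Fin m → ZMod 2) : shiftMat a * shiftMat a = 1 := by
  rw [shiftMat_mul_shiftMat, add_self_eq_zero_of_module, shiftMat_zero]

lemma signMat_mul_self (a : Fin m → ZMod 2) : signMat a * signMat a = 1 := by
  rw [signMat_mul_signMat, add_self_eq_zero_of_module, signMat_zero]

/-- The shift matrix as an orthogonal transformation. -/
def shiftO (a : Fin m → ZMod 2) : Matrix.orthogonalGroup (Fin m → ZMod 2) ℝ :=
  ⟨shiftMat a, mem_orthogonalGroup_of_symm (shiftMat_transpose a) (shiftMat_mul_self a)⟩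

/-- The sign matrix as an orthogonal transformation. -/
def signO (b : Fin m → ZMod 2) : Matrix.orthogonalGroup (Fin m → ZMod 2) ℝ :=
  ⟨signMat b, mem_orthogonalGroup_of_symm (signMat_transpose b) (signMat_mul_self b)⟩

@[simp] lemma coe_shiftO (a : Fin m → ZMod 2) :
    ((shiftO a : Matrix.orthogonalGroup (Fin m → ZMod 2) ℝ) : Matrix _ _ ℝ) = shiftMat a := rfl

@[simp] lemma coe_signO (a : Fin m → ZMod 2) :
    ((signO a : Matrix.orthogonalGroup (Fin m → ZMod 2) ℝ) : Matrix _ _ ℝ) = signMat a := rfl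

lemma tensorAt_sigmaOne (j : Fin m) : tensorAt j sigmaOne = shiftMat (Pi.single j 1) := by
  ext w v
  have hz : ∀ x y : ZMod 2, x ≠ y ↔ y = x + 1 := by decide
  have key : ∀ i, (Function.update (fun _ => (1 : Matrix (ZMod 2) (ZMod 2) ℝ)) j sigmaOne) i
      (w i) (v i) = if v i = w i + (Pi.single j 1 : Fin m → ZMod 2) i then 1 else 0 := by
    intro i
    by_cases h : i = j
    · subst h
      rw [Function.update_self]
      by_cases h' : w i = v i
      · simp [sigmaOne, h']
      · simp [sigmaOne, (hz _ _).1 h']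
    · rw [Function.update_of_ne h]
      simp [Matrix.one_apply, Pi.single_eq_of_ne h, eq_comm]
  simp only [tensorAt, tensorMatrix, Matrix.of_apply, key, shiftMat]
  rw [Finset.prod_ite_zero]
  simp [funext_iff]

lemma tensorAt_sigmaTwo (j : Fin m) : tensorAt j sigmaTwo = signMat (Pi.single j 1) := by
  ext w v
  have key : ∀ i, (Function.update (fun _ => (1 : Matrix (ZMod 2) (ZMod 2) ℝ)) j sigmaTwo) i
      (w i) (v i) = if w i = v i then parity ((Pi.single j 1 : Fin m → ZMod 2) i * v i) else 0 := by
    intro i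
    by_cases h : i = j
    · subst h
      rw [Function.update_self]
      by_cases h' : w i = v i
      · simp [sigmaTwo, h', parity]
      · simp [sigmaTwo, h']
    · rw [Function.update_of_ne h]
      simp [Matrix.one_apply, Pi.single_eq_of_ne h]
  simp only [tensorAt, tensorMatrix, Matrix.of_apply, key, signMat]
  rw [Finset.prod_ite_zero, ← parity_sum]
  by_cases h : w = v
  · subst h
    simp [dotProduct]
  · rw [Matrix.diagonal_apply_ne _ h, if_neg]
    simpa [funext_iff] using h

lemma extraspecialGroup_eq : extraspecialGroup m = Subgroup.closure
    {g | ∃ i : Fin m, g = shiftO (Pi.single i 1) ∨ g = signO (Pi.single i 1)} := by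
  simp only [extraspecialGroup, tensorAt_sigmaOne, tensorAt_sigmaTwo, Subtype.ext_iff, coe_shiftO,
    coe_signO]

lemma pi_zmod_two_induction {p : (Fin m → ZMod 2) → Prop} (h0 : p 0)
    (h1 : ∀ i, p (Pi.single i 1)) (hadd : ∀ a b, p a → p b → p (a + b)) (a) : p a := by
  rw [← Finset.univ_sum_single a]
  refine Finset.sum_induction _ p hadd h0 fun i _ => ?_
  rcases zmod_two_cases (a i) with h | h <;> rw [h]
  · rwa [Pi.single_zero]
  · exact h1 i

lemma shiftO_mem (a : Fin m → ZMod 2) : shiftO a ∈ extraspecialGroup m := by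
  refine pi_zmod_two_induction (p := fun a => shiftO a ∈ extraspecialGroup m) ?_ ?_ ?_ a
  · rw [show shiftO (0 : Fin m → ZMod 2) = 1 from Subtype.ext shiftMat_zero]
    exact one_mem _
  · intro i
    rw [extraspecialGroup_eq]
    exact Subgroup.subset_closure ⟨i, Or.inl rfl⟩
  · intro a b ha hb
    rw [show shiftO (a + b) = shiftO a * shiftO b from
      Subtype.ext (shiftMat_mul_shiftMat a b).symm]
    exact mul_mem ha hb

lemma signO_mem (a : Fin m → ZMod 2) : signO a ∈ extraspecialGroup m := by
  refine pi_zmod_two_induction (p := fun a => signO a ∈ extraspecialGroup m) ?_ ?_ ?_ a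
  · rw [show signO (0 : Fin m → ZMod 2) = 1 from Subtype.ext signMat_zero]
    exact one_mem _
  · intro i
    rw [extraspecialGroup_eq]
    exact Subgroup.subset_closure ⟨i, Or.inr rfl⟩
  · intro a b ha hb
    rw [show signO (a + b) = signO a * signO b from
      Subtype.ext (signMat_mul_signMat a b).symm]
    exact mul_mem ha hb

/-! ### Finiteness of the Clifford group -/

/-- Moving a sign matrix past a shift costs only a sign, so these signed products are closed under
multiplication. This normal form makes E(m) finite. -/
lemma exists_eq_of_mem_extraspecialGroup {g : Matrix.orthogonalGroup (Fin m → ZMod 2) ℝ}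
    (hg : g ∈ extraspecialGroup m) : ∃ (x : ZMod 2) (a b : Fin m → ZMod 2),
      (g : Matrix (Fin m → ZMod 2) (Fin m → ZMod 2) ℝ) =
        parity x • (shiftMat a * signMat b) := by
  have hmul : ∀ (x y : ZMod 2) (a b c d : Fin m → ZMod 2),
      (parity x • (shiftMat a * signMat b)) * (parity y • (shiftMat c * signMat d)) =
        parity (x + y + b ⬝ᵥ c) • (shiftMat (a + c) * signMat (b + d)) := by
    intro x y a b c d
    rw [smul_mul_smul_comm, mul_assoc, ← mul_assoc (signMat b), signMat_mul_shiftMat,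
      smul_mul_assoc, mul_smul_comm, smul_smul, mul_assoc (shiftMat c), signMat_mul_signMat,
      ← mul_assoc, shiftMat_mul_shiftMat, parity_add, parity_add]
  rw [extraspecialGroup_eq] at hg
  induction hg using Subgroup.closure_induction with
  | mem g hg =>
    obtain ⟨i, rfl | rfl⟩ := hg
    · exact ⟨0, Pi.single i 1, 0, by simp [signMat_zero]⟩
    · exact ⟨0, 0, Pi.single i 1, by simp [shiftMat_zero]⟩
  | one => exact ⟨0, 0, 0, by simp [signMat_zero, shiftMat_zero]⟩
  | mul g h _ _ hg hh =>
    obtain ⟨x, a, b, hg⟩ := hg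
    obtain ⟨y, c, d, hh⟩ := hh
    exact ⟨_, _, _, by rw [Submonoid.coe_mul, hg, hh, hmul]⟩
  | inv g _ hg =>
    obtain ⟨x, a, b, hg⟩ := hg
    -- The square of X_a Z_b is (-1)^(b·a), so the inverse carries the extra exponent b·a.
    have hone := hmul x (x + b ⬝ᵥ a) a b a b
    rw [show x + (x + b ⬝ᵥ a) + b ⬝ᵥ a = 0 by
      rw [add_assoc, add_assoc, add_self_eq_zero_of_module, add_zero, add_self_eq_zero_of_module],
      add_self_eq_zero_of_module, add_self_eq_zero_of_module, shiftMat_zero, signMat_zero,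
      parity_zero, mul_one, one_smul, ← hg] at hone
    refine ⟨x + b ⬝ᵥ a, a, b, ?_⟩
    have := congrArg (fun M => ((g⁻¹ : Matrix.orthogonalGroup (Fin m → ZMod 2) ℝ) :
      Matrix (Fin m → ZMod 2) (Fin m → ZMod 2) ℝ) * M) hone
    simp only [mul_one] at this
    rw [← this, ← mul_assoc, ← Submonoid.coe_mul, inv_mul_cancel, Submonoid.coe_one, one_mul]

instance finite_extraspecialGroup : Finite (extraspecialGroup m) := by
  have hf : (Set.range fun t : ZMod 2 × (Fin m → ZMod 2) × (Fin m → ZMod 2) =>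
      parity t.1 • (shiftMat t.2.1 * signMat t.2.2)).Finite := Set.finite_range _
  refine Set.Finite.of_finite_image (f := Subtype.val) (hf.subset ?_)
    Subtype.val_injective.injOn
  rintro _ ⟨g, hg, rfl⟩
  obtain ⟨x, a, b, h⟩ := exists_eq_of_mem_extraspecialGroup hg
  exact ⟨⟨x, a, b⟩, h.symm⟩

/-- Commuting with shifts makes the diagonal constant, commuting with signs kills the off-diagonal
entries, and orthogonality leaves only ±1. -/
lemma eq_one_or_of_commute {g : Matrix.orthogonalGroup (Fin m → ZMod 2) ℝ}
    (hg : ∀ e ∈ extraspecialGroup m, e * g = g * e) :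
    (g : Matrix (Fin m → ZMod 2) (Fin m → ZMod 2) ℝ) = 1 ∨
      (g : Matrix (Fin m → ZMod 2) (Fin m → ZMod 2) ℝ) = -1 := by
  set A := (g : Matrix (Fin m → ZMod 2) (Fin m → ZMod 2) ℝ) with hA
  have hdiag : ∀ w, A w w = A 0 0 := by
    intro w
    have h := congrFun (congrFun (congrArg Subtype.val (hg _ (shiftO_mem w))) 0) w
    change (shiftMat w * A) 0 w = (A * shiftMat w) 0 w at h
    rwa [shiftMat_mul_apply, mul_shiftMat_apply, zero_add, add_self_eq_zero_of_module] at h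
  have hoff : ∀ w v, w ≠ v → A w v = 0 := by
    intro w v hwv
    obtain ⟨j, hj⟩ := Function.ne_iff.1 hwv
    have h := congrFun (congrFun (congrArg Subtype.val (hg _ (signO_mem (Pi.single j 1)))) w) v
    change (signMat (Pi.single j 1) * A) w v = (A * signMat (Pi.single j 1)) w v at h
    rw [signMat, Matrix.diagonal_mul, Matrix.mul_diagonal, single_one_dotProduct,
      single_one_dotProduct] at h
    rcases zmod_two_cases (w j) with hw | hw <;> rcases zmod_two_cases (v j) with hv | hv <;>
      rw [hw, hv] at h hj <;> simp at h hj <;> linarith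
  have hscal : A = A 0 0 • 1 := by
    ext w v
    by_cases h : w = v
    · subst h
      simp [hdiag w]
    · simp [hoff w v h, h]
  have hsq : A 0 0 * A 0 0 = 1 := by
    have h := (Matrix.mem_orthogonalGroup_iff _ _).1 g.2
    rw [← hA, hscal, Matrix.transpose_smul, Matrix.transpose_one, smul_mul_smul_comm, one_mul] at h
    simpa using congrFun (congrFun h 0) 0
  rcases mul_self_eq_one_iff.1 hsq with h | h <;> rw [h] at hscal
  · exact Or.inl (by rw [hscal, one_smul])
  · exact Or.inr (by rw [hscal, neg_one_smul])

/-- Conjugation maps the normalizer to the automorphisms of the finite group E(m); the kernel is the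
centralizer, contained in {1, -1}. -/
instance finite_cliffordGroup : Finite (cliffordGroup m) := by
  have hker : Finite (extraspecialGroup m).normalizerMonoidHom.ker := by
    rw [Subgroup.normalizerMonoidHom_ker]
    have hf : ({1, -1} : Set (Matrix (Fin m → ZMod 2) (Fin m → ZMod 2) ℝ)).Finite := by simp
    refine Set.Finite.of_finite_image
      (f := fun g : Subgroup.normalizer
        (extraspecialGroup m : Set (Matrix.orthogonalGroup (Fin m → ZMod 2) ℝ)) =>
          ((g : Matrix.orthogonalGroup (Fin m → ZMod 2) ℝ) :
            Matrix (Fin m → ZMod 2) (Fin m → ZMod 2) ℝ))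
      (hf.subset ?_) (fun x _ y _ h => Subtype.ext (Subtype.ext h))
    rintro _ ⟨g, hg, rfl⟩
    exact eq_one_or_of_commute (Subgroup.mem_centralizer_iff.1 hg)
  have hrange : Finite (extraspecialGroup m).normalizerMonoidHom.range := by
    have : Finite (MulAut (extraspecialGroup m)) :=
      Finite.of_injective (fun f => (f : extraspecialGroup m → extraspecialGroup m))
        DFunLike.coe_injective
    infer_instance
  exact ((extraspecialGroup m).normalizerMonoidHom.finite_iff_finite_ker_range).2 ⟨hker, hrange⟩

/-! ### Reflections in the Clifford group -/

/-- The reflection `(X_a + Z_b) / √2`. -/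
def hadamard (a b : Fin m → ZMod 2) : Matrix (Fin m → ZMod 2) (Fin m → ZMod 2) ℝ :=
  (Real.sqrt 2)⁻¹ • (shiftMat a + signMat b)

lemma inv_sqrt_two_mul_self : (Real.sqrt 2)⁻¹ * (Real.sqrt 2)⁻¹ = 2⁻¹ := by
  rw [← mul_inv, Real.mul_self_sqrt (by norm_num)]

lemma signMat_mul_shiftMat_of_dotProduct_eq_one {a b : Fin m → ZMod 2} (hab : b ⬝ᵥ a = 1) :
    signMat b * shiftMat a = -(shiftMat a * signMat b) := by
  rw [signMat_mul_shiftMat, hab, parity_one, neg_one_smul]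

lemma hadamard_mul_self {a b : Fin m → ZMod 2} (hab : b ⬝ᵥ a = 1) :
    hadamard a b * hadamard a b = 1 := by
  rw [hadamard, smul_mul_smul_comm, inv_sqrt_two_mul_self, add_mul, mul_add, mul_add,
    shiftMat_mul_self, signMat_mul_self, signMat_mul_shiftMat_of_dotProduct_eq_one hab]
  rw [show (1 : Matrix (Fin m → ZMod 2) (Fin m → ZMod 2) ℝ) + shiftMat a * signMat b +
    (-(shiftMat a * signMat b) + 1) = (2 : ℝ) • 1 by rw [two_smul]; abel, smul_smul]
  norm_num

/-- The reflection `(X_a + Z_b) / √2` as an orthogonal transformation. -/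
def hadamardO (a b : Fin m → ZMod 2) (hab : b ⬝ᵥ a = 1) :
    Matrix.orthogonalGroup (Fin m → ZMod 2) ℝ :=
  ⟨hadamard a b, mem_orthogonalGroup_of_symm
    (by simp [hadamard, shiftMat_transpose, signMat_transpose]) (hadamard_mul_self hab)⟩

lemma hadamardO_inv {a b : Fin m → ZMod 2} (hab : b ⬝ᵥ a = 1) :
    (hadamardO a b hab)⁻¹ = hadamardO a b hab :=
  inv_eq_of_mul_eq_one_right (Subtype.ext (hadamard_mul_self hab))

/-- If b·c = 0 the reflection commutes with X_c. Otherwise moving it past X_c flips the sign of Z_b,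
and (X_a - Z_b)(X_a + Z_b) = 2 X_a Z_b by anticommutation. -/
lemma hadamardO_conj_shiftO_mem {a b : Fin m → ZMod 2} (hab : b ⬝ᵥ a = 1) (c : Fin m → ZMod 2) :
    hadamardO a b hab * shiftO c * hadamardO a b hab ∈ extraspecialGroup m := by
  have hX : shiftMat a * shiftMat c = shiftMat c * shiftMat a := by
    rw [shiftMat_mul_shiftMat, shiftMat_mul_shiftMat, add_comm]
  rcases zmod_two_cases (b ⬝ᵥ c) with hc | hc
  · rw [show hadamardO a b hab * shiftO c * hadamardO a b hab = shiftO c from ?_]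
    · exact shiftO_mem c
    · refine Subtype.ext ?_
      change hadamard a b * shiftMat c * hadamard a b = shiftMat c
      have : hadamard a b * shiftMat c = shiftMat c * hadamard a b := by
        rw [hadamard, smul_mul_assoc, mul_smul_comm, add_mul, mul_add, hX, signMat_mul_shiftMat,
          hc, parity_zero, one_smul]
      rw [this, mul_assoc, hadamard_mul_self hab, mul_one]
  · rw [show hadamardO a b hab * shiftO c * hadamardO a b hab =
      shiftO c * (shiftO a * signO b) from ?_]
    · exact mul_mem (shiftO_mem c) (mul_mem (shiftO_mem a) (signO_mem b))
    · refine Subtype.ext ?_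
      change hadamard a b * shiftMat c * hadamard a b = shiftMat c * (shiftMat a * signMat b)
      have h1 : hadamard a b * shiftMat c =
          (Real.sqrt 2)⁻¹ • (shiftMat c * (shiftMat a - signMat b)) := by
        rw [hadamard, smul_mul_assoc, add_mul, mul_sub, hX, signMat_mul_shiftMat, hc, parity_one,
          neg_one_smul, ← sub_eq_add_neg]
      rw [h1, hadamard, smul_mul_smul_comm, inv_sqrt_two_mul_self, mul_assoc, sub_mul, mul_add,
        mul_add, shiftMat_mul_self, signMat_mul_self,
        signMat_mul_shiftMat_of_dotProduct_eq_one hab,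
        show (1 : Matrix (Fin m → ZMod 2) (Fin m → ZMod 2) ℝ) + shiftMat a * signMat b -
          (-(shiftMat a * signMat b) + 1) = (2 : ℝ) • (shiftMat a * signMat b) by
            rw [two_smul]; abel, mul_smul_comm, smul_smul]
      norm_num

lemma hadamardO_conj_signO_mem {a b : Fin m → ZMod 2} (hab : b ⬝ᵥ a = 1) (c : Fin m → ZMod 2) :
    hadamardO a b hab * signO c * hadamardO a b hab ∈ extraspecialGroup m := by
  have hZ : signMat b * signMat c = signMat c * signMat b := by
    rw [signMat_mul_signMat, signMat_mul_signMat, add_comm]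
  rcases zmod_two_cases (c ⬝ᵥ a) with hc | hc
  · rw [show hadamardO a b hab * signO c * hadamardO a b hab = signO c from ?_]
    · exact signO_mem c
    · refine Subtype.ext ?_
      change hadamard a b * signMat c * hadamard a b = signMat c
      have : hadamard a b * signMat c = signMat c * hadamard a b := by
        rw [hadamard, smul_mul_assoc, mul_smul_comm, add_mul, mul_add, hZ, shiftMat_mul_signMat,
          hc, parity_zero, one_smul]
      rw [this, mul_assoc, hadamard_mul_self hab, mul_one]
  · rw [show hadamardO a b hab * signO c * hadamardO a b hab =
      signO c * (signO b * shiftO a) from ?_]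
    · exact mul_mem (signO_mem c) (mul_mem (signO_mem b) (shiftO_mem a))
    · refine Subtype.ext ?_
      change hadamard a b * signMat c * hadamard a b = signMat c * (signMat b * shiftMat a)
      have h1 : hadamard a b * signMat c =
          (Real.sqrt 2)⁻¹ • (signMat c * (signMat b - shiftMat a)) := by
        rw [hadamard, smul_mul_assoc, add_mul, mul_sub, hZ, shiftMat_mul_signMat, hc, parity_one,
          neg_one_smul, add_comm, ← sub_eq_add_neg]
      rw [h1, hadamard, smul_mul_smul_comm, inv_sqrt_two_mul_self, mul_assoc, sub_mul, mul_add,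
        mul_add, shiftMat_mul_self, signMat_mul_self,
        signMat_mul_shiftMat_of_dotProduct_eq_one hab,
        show -(shiftMat a * signMat b) + 1 -
          ((1 : Matrix (Fin m → ZMod 2) (Fin m → ZMod 2) ℝ) + shiftMat a * signMat b) =
            (2 : ℝ) • -(shiftMat a * signMat b) by
            rw [two_smul]; abel, mul_smul_comm, smul_smul]
      norm_num

lemma hadamardO_mem_cliffordGroup {a b : Fin m → ZMod 2} (hab : b ⬝ᵥ a = 1) :
    hadamardO a b hab ∈ cliffordGroup m := by
  set h := hadamardO a b hab with hh
  have hinv : h⁻¹ = h := hadamardO_inv hab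
  have hone : h * h = 1 := by
    nth_rewrite 1 [← hinv]
    exact inv_mul_cancel h
  have key : ∀ e ∈ extraspecialGroup m, h * e * h ∈ extraspecialGroup m := by
    intro e he
    have hle : extraspecialGroup m ≤
        (extraspecialGroup m).comap (MulAut.conj h).toMonoidHom := by
      conv_lhs => rw [extraspecialGroup_eq]
      rw [Subgroup.closure_le]
      rintro g ⟨i, rfl | rfl⟩
      · simpa [hinv] using hadamardO_conj_shiftO_mem hab (Pi.single i 1)
      · simpa [hinv] using hadamardO_conj_signO_mem hab (Pi.single i 1)
    simpa [hinv] using hle he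
  refine Subgroup.mem_normalizer_iff.2 fun e => ?_
  rw [hinv]
  -- The reflection is an involution, so conjugating twice gives the converse inclusion.
  refine ⟨key e, fun he => ?_⟩
  have := key _ he
  rwa [show h * (h * e * h) * h = (h * h) * e * (h * h) by simp only [mul_assoc], hone, one_mul,
    mul_one] at this

end ShiftSign

/-! ### Kronecker products -/

section Kron

variable {ι κ : Type*} [Fintype ι]

/-- The Kronecker product of a family of square matrices. -/
def kron (A : ι → Matrix κ κ ℝ) : Matrix (ι → κ) (ι → κ) ℝ :=
  Matrix.of fun w v => ∏ i, A i (w i) (v i)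

lemma kron_mul_kron [DecidableEq ι] [Fintype κ] (A B : ι → Matrix κ κ ℝ) :
    kron A * kron B = kron fun i => A i * B i := by
  ext w v
  simp only [kron, Matrix.mul_apply, Matrix.of_apply, ← Finset.prod_mul_distrib]
  rw [Finset.prod_univ_sum, Fintype.piFinset_univ]

lemma kron_diagonal [DecidableEq κ] [DecidableEq (ι → κ)] (f : ι → κ → ℝ) :
    kron (fun i => Matrix.diagonal (f i)) = Matrix.diagonal fun v => ∏ i, f i (v i) := by
  ext w v
  simp only [kron, Matrix.of_apply, Matrix.diagonal_apply]
  rw [Finset.prod_ite_zero]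
  simp [funext_iff]

lemma kron_one [DecidableEq κ] [DecidableEq (ι → κ)] :
    kron (fun _ : ι => (1 : Matrix κ κ ℝ)) = 1 := by
  simp_rw [← Matrix.diagonal_one, kron_diagonal, Finset.prod_const_one]

lemma kron_transpose (A : ι → Matrix κ κ ℝ) :
    (kron A).transpose = kron fun i => (A i).transpose := rfl

lemma kron_smul (c : ℝ) (A : ι → Matrix κ κ ℝ) :
    kron (fun i => c • A i) = c ^ Fintype.card ι • kron A := by
  ext w v
  simp [kron, Finset.prod_mul_distrib]

lemma kron_sum [DecidableEq ι] {α : Type*} [Fintype α] (A : ι → α → Matrix κ κ ℝ) :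
    kron (fun i => ∑ x, A i x) = ∑ x : ι → α, kron fun i => A i (x i) := by
  ext w v
  simp only [kron, Matrix.of_apply, Matrix.sum_apply]
  rw [Finset.prod_univ_sum, Fintype.piFinset_univ]

lemma kron_shiftMat_mulVec [DecidableEq ι] {m : ℕ} (s : ι → Fin m → ZMod 2)
    (t : (ι → Fin m → ZMod 2) → ℝ) :
    (kron fun i => shiftMat (s i)).mulVec t = fun w => t (w + s) := by
  ext w
  have h : ∀ v, (kron fun i => shiftMat (s i)) w v = if v = w + s then 1 else 0 := by
    intro v
    simp only [kron, shiftMat, Matrix.of_apply]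
    rw [Finset.prod_ite_zero]
    simp only [Finset.mem_univ, forall_const, Finset.prod_const_one, funext_iff (f := v),
      Pi.add_apply]
  simp [Matrix.mulVec, dotProduct, h]

lemma kron_signMat_mulVec [DecidableEq ι] {m : ℕ} (s : ι → Fin m → ZMod 2)
    (t : (ι → Fin m → ZMod 2) → ℝ) :
    (kron fun i => signMat (s i)).mulVec t = fun w => parity (∑ i, s i ⬝ᵥ w i) * t w := by
  ext w
  simp only [signMat]
  rw [kron_diagonal, Matrix.mulVec_diagonal, parity_sum]

end Kron

/-! ### Powers of codes and their indicator tensors -/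

section Tensor

variable {m N : ℕ}

/-- The `m`-th power `Cᵐ ≅ C ⊗ 𝔽₂ᵐ` of a code, as a code over the alphabet `𝔽₂ᵐ`. -/
def powCode (m : ℕ) (C : BinaryCode N) : Submodule (ZMod 2) (Fin N → Fin m → ZMod 2) where
  carrier := {v | ∀ j, (fun i => v i j) ∈ C}
  add_mem' hv hw j := C.add_mem (hv j) (hw j)
  zero_mem' _ := C.zero_mem
  smul_mem' a _ hv j := C.smul_mem a (hv j)

lemma mem_powCode {C : BinaryCode N} {v : Fin N → Fin m → ZMod 2} :
    v ∈ powCode m C ↔ ∀ j, (fun i => v i j) ∈ C := Iff.rfl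

/-- The pure tensor `d ⊗ a`. -/
def outer (a : Fin m → ZMod 2) (d : Fin N → ZMod 2) : Fin N → Fin m → ZMod 2 := fun i => d i • a

lemma outer_mem_powCode {C : BinaryCode N} {d : Fin N → ZMod 2} (hd : d ∈ C)
    (a : Fin m → ZMod 2) : outer a d ∈ powCode m C := by
  intro j
  convert! C.smul_mem (a j) hd using 1
  ext i
  simp [outer, mul_comm]

lemma outer_add (a : Fin m → ZMod 2) (c d : Fin N → ZMod 2) :
    outer a (c + d) = outer a c + outer a d := by
  ext i
  simp [outer, add_mul]

/-- The contraction of a word over `𝔽₂ᵐ` with the functional `b`. -/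
def contract (b : Fin m → ZMod 2) (w : Fin N → Fin m → ZMod 2) : Fin N → ZMod 2 :=
  fun i => b ⬝ᵥ w i

lemma contract_mem {C : BinaryCode N} {w : Fin N → Fin m → ZMod 2} (hw : w ∈ powCode m C)
    (b : Fin m → ZMod 2) : contract b w ∈ C := by
  have : contract b w = ∑ j, b j • fun i => w i j := by
    ext i
    simp [contract, dotProduct]
  rw [this]
  exact C.sum_mem fun j _ => C.smul_mem _ (hw j)

lemma contract_add_outer (a b : Fin m → ZMod 2) (w : Fin N → Fin m → ZMod 2)
    (d : Fin N → ZMod 2) : contract b (w + outer a d) = contract b w + (b ⬝ᵥ a) • d := by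
  ext i
  simp [contract, outer, dotProduct_add, mul_comm]

open Classical in
/-- The indicator function of `Cᵐ`, as a tensor in `(ℝ^{𝔽₂ᵐ})^{⊗ N}`. -/
def codeTensor (m : ℕ) (C : BinaryCode N) : (Fin N → Fin m → ZMod 2) → ℝ :=
  fun v => if v ∈ powCode m C then 1 else 0

lemma codeTensor_of_mem {C : BinaryCode N} {v : Fin N → Fin m → ZMod 2} (h : v ∈ powCode m C) :
    codeTensor m C v = 1 := if_pos h

lemma codeTensor_of_notMem {C : BinaryCode N} {v : Fin N → Fin m → ZMod 2}
    (h : v ∉ powCode m C) : codeTensor m C v = 0 := if_neg h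

lemma codeTensor_add_of_mem {C : BinaryCode N} {u : Fin N → Fin m → ZMod 2}
    (h : u ∈ powCode m C) (v : Fin N → Fin m → ZMod 2) :
    codeTensor m C (v + u) = codeTensor m C v := by
  unfold codeTensor
  rw [Submodule.add_mem_iff_left _ h]

/-! ### Invariance of the indicator tensors of self-dual codes -/

/-- The action of `e` on the tensor factors in the support of `c`. -/
def supportKron (e : Matrix (Fin m → ZMod 2) (Fin m → ZMod 2) ℝ) (c : Fin N → ZMod 2) :
    Matrix (Fin N → Fin m → ZMod 2) (Fin N → Fin m → ZMod 2) ℝ :=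
  kron fun i => if c i = 0 then 1 else e

lemma supportKron_mul (e f : Matrix (Fin m → ZMod 2) (Fin m → ZMod 2) ℝ) (c : Fin N → ZMod 2) :
    supportKron (e * f) c = supportKron e c * supportKron f c := by
  rw [supportKron, supportKron, supportKron, kron_mul_kron]
  congr 1
  ext1 i
  split_ifs <;> simp

lemma supportKron_one (c : Fin N → ZMod 2) :
    supportKron (1 : Matrix (Fin m → ZMod 2) (Fin m → ZMod 2) ℝ) c = 1 := by
  simp [supportKron, kron_one]

lemma supportKron_shiftMat_mulVec (a : Fin m → ZMod 2) (c : Fin N → ZMod 2)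
    (t : (Fin N → Fin m → ZMod 2) → ℝ) :
    (supportKron (shiftMat a) c).mulVec t = fun w => t (w + outer a c) := by
  have : (fun i => if c i = 0 then 1 else shiftMat a) = fun i => shiftMat (outer a c i) := by
    ext1 i
    rcases zmod_two_cases (c i) with h | h <;> simp [outer, h, shiftMat_zero]
  rw [supportKron, this, kron_shiftMat_mulVec]

lemma supportKron_signMat_mulVec (b : Fin m → ZMod 2) (c : Fin N → ZMod 2)
    (t : (Fin N → Fin m → ZMod 2) → ℝ) :
    (supportKron (signMat b) c).mulVec t = fun w => parity (c ⬝ᵥ contract b w) * t w := by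
  have : (fun i => if c i = 0 then 1 else signMat b) = fun i => signMat (c i • b) := by
    ext1 i
    rcases zmod_two_cases (c i) with h | h <;> simp [h, signMat_zero]
  rw [supportKron, this, kron_signMat_mulVec]
  simp [dotProduct, contract, Finset.mul_sum, mul_assoc]

/-- It suffices to check generators: shifts translate by an element of C^m, and signs are trivial on
C^m by self-orthogonality. -/
lemma supportKron_mulVec_codeTensor {C : BinaryCode N} (hC : IsSelfOrthogonal C)
    {e : Matrix.orthogonalGroup (Fin m → ZMod 2) ℝ} (he : e ∈ extraspecialGroup m)
    {c : Fin N → ZMod 2} (hc : c ∈ C) :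
    (supportKron (e : Matrix (Fin m → ZMod 2) (Fin m → ZMod 2) ℝ) c).mulVec (codeTensor m C) =
      codeTensor m C := by
  rw [extraspecialGroup_eq] at he
  induction he using Subgroup.closure_induction with
  | mem e he =>
    obtain ⟨i, rfl | rfl⟩ := he
    · rw [coe_shiftO, supportKron_shiftMat_mulVec]
      ext w
      exact codeTensor_add_of_mem (outer_mem_powCode hc _) w
    · rw [coe_signO, supportKron_signMat_mulVec]
      ext w
      by_cases hw : w ∈ powCode m C
      · rw [hC (contract_mem hw _) c hc, parity_zero, one_mul]
      · rw [codeTensor_of_notMem hw, mul_zero]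
  | one => rw [Submonoid.coe_one, supportKron_one, Matrix.one_mulVec]
  | mul e f _ _ he hf => rw [Submonoid.coe_mul, supportKron_mul, ← Matrix.mulVec_mulVec, hf, he]
  | inv e _ he =>
    conv_lhs => rw [← he]
    rw [Matrix.mulVec_mulVec, ← supportKron_mul, ← Submonoid.coe_mul, inv_mul_cancel,
      Submonoid.coe_one, supportKron_one, Matrix.one_mulVec]

lemma exists_dotProduct_eq_one {C : BinaryCode N} {x : Fin N → ZMod 2} (hx : x ∉ dualCode C) :
    ∃ c ∈ C, c ⬝ᵥ x = 1 := by
  by_contra! h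
  exact hx fun c hc => (zmod_two_cases _).resolve_right (h c hc)

lemma contract_single (w : Fin N → Fin m → ZMod 2) (j : Fin m) :
    contract (Pi.single j 1) w = fun i => w i j := by
  ext i
  simp [contract]

lemma sum_outer_single (w : Fin N → Fin m → ZMod 2) :
    ∑ j, outer (Pi.single j 1) (fun i => w i j) = w := by
  ext i j
  simp [outer, Finset.sum_apply, Pi.single_apply]

/-- The sign matrices force the support into (C^⊥)^m = C^m, and the shifts make t constant there. -/
lemma eq_smul_codeTensor {C : BinaryCode N} (hC : IsSelfDual C)
    {t : (Fin N → Fin m → ZMod 2) → ℝ}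
    (ht : ∀ e ∈ extraspecialGroup m, ∀ c ∈ C,
      (supportKron (e : Matrix (Fin m → ZMod 2) (Fin m → ZMod 2) ℝ) c).mulVec t = t) :
    t = t 0 • codeTensor m C := by
  have hshift : ∀ a, ∀ c ∈ C, ∀ w, t (w + outer a c) = t w := by
    intro a c hc w
    have := congrFun (ht _ (shiftO_mem a) c hc) w
    rwa [coe_shiftO, supportKron_shiftMat_mulVec] at this
  have hsign : ∀ b, ∀ c ∈ C, ∀ w, parity (c ⬝ᵥ contract b w) * t w = t w := by
    intro b c hc w
    have := congrFun (ht _ (signO_mem b) c hc) w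
    rwa [coe_signO, supportKron_signMat_mulVec] at this
  ext w
  rw [Pi.smul_apply, smul_eq_mul]
  by_cases hw : w ∈ powCode m C
  · rw [codeTensor_of_mem hw, mul_one]
    have key : ∀ s : Finset (Fin m),
        t (∑ j ∈ s, outer (Pi.single j 1) (fun i => w i j)) = t 0 := by
      intro s
      induction s using Finset.induction_on with
      | empty => simp
      | insert j s hj ih => rw [Finset.sum_insert hj, add_comm, hshift _ _ (hw j), ih]
    rw [← key Finset.univ, sum_outer_single]
  · rw [codeTensor_of_notMem hw, mul_zero]
    obtain ⟨j, hj⟩ := not_forall.1 hw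
    rw [hC] at hj
    -- A codeword not orthogonal to the bad coordinate row of w yields -t w = t w.
    obtain ⟨c, hc, hcw⟩ := exists_dotProduct_eq_one hj
    have := hsign (Pi.single j 1) c hc w
    rw [contract_single, hcw, parity_one] at this
    linarith

/-- The tensor power of a matrix acting on `(ℝ^{𝔽₂ᵐ})^{⊗ N}`. -/
abbrev tensorPow (N : ℕ) (g : Matrix (Fin m → ZMod 2) (Fin m → ZMod 2) ℝ) :
    Matrix (Fin N → Fin m → ZMod 2) (Fin N → Fin m → ZMod 2) ℝ :=
  kron fun _ => g

lemma orthogonal_transpose_mul_self {n : Type*} [Fintype n] [DecidableEq n]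
    (g : Matrix.orthogonalGroup n ℝ) :
    (g : Matrix n n ℝ).transpose * (g : Matrix n n ℝ) = 1 :=
  (Matrix.mem_orthogonalGroup_iff' _ _).1 g.2

lemma orthogonal_mul_transpose_self {n : Type*} [Fintype n] [DecidableEq n]
    (g : Matrix.orthogonalGroup n ℝ) :
    (g : Matrix n n ℝ) * (g : Matrix n n ℝ).transpose = 1 :=
  (Matrix.mem_orthogonalGroup_iff _ _).1 g.2

lemma tensorPow_dotProduct (g : Matrix.orthogonalGroup (Fin m → ZMod 2) ℝ)
    (s t : (Fin N → Fin m → ZMod 2) → ℝ) :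
    (tensorPow N (g : Matrix _ _ ℝ)).mulVec s ⬝ᵥ (tensorPow N (g : Matrix _ _ ℝ)).mulVec t =
      s ⬝ᵥ t := by
  rw [Matrix.dotProduct_mulVec, ← Matrix.mulVec_transpose, Matrix.mulVec_mulVec,
    kron_transpose, kron_mul_kron, orthogonal_transpose_mul_self, kron_one, Matrix.one_mulVec]

/-- The indicator tensor of the words `(u, u)` of length `k + k`. -/
def pairTensor (m k : ℕ) : (Fin (k + k) → Fin m → ZMod 2) → ℝ :=
  fun v => if (fun i => v (Fin.castAdd k i)) = (fun i => v (Fin.natAdd k i)) then 1 else 0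

/-- Splitting a word into halves, the value of the image is an entry of the k-th tensor power of g
gᵀ = 1. -/
lemma tensorPow_mulVec_pairTensor (k : ℕ) (g : Matrix.orthogonalGroup (Fin m → ZMod 2) ℝ) :
    (tensorPow (k + k) (g : Matrix _ _ ℝ)).mulVec (pairTensor m k) = pairTensor m k := by
  ext w
  set A := (g : Matrix (Fin m → ZMod 2) (Fin m → ZMod 2) ℝ) with hA
  have h1 : (kron (fun _ : Fin k => A) * kron fun _ : Fin k => A.transpose :
      Matrix (Fin k → Fin m → ZMod 2) (Fin k → Fin m → ZMod 2) ℝ)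
      (fun i => w (Fin.castAdd k i)) (fun i => w (Fin.natAdd k i)) = pairTensor m k w := by
    rw [kron_mul_kron, orthogonal_mul_transpose_self, kron_one, pairTensor, Matrix.one_apply]
  rw [← h1, Matrix.mulVec, dotProduct, ← (Fin.appendEquiv k k).sum_comp, Fintype.sum_prod_type,
    Matrix.mul_apply]
  refine Finset.sum_congr rfl fun u _ => ?_
  simp only [kron, pairTensor, Fin.prod_univ_add, Fin.appendEquiv, Equiv.coe_fn_mk,
    Fin.append_left, Fin.append_right, Matrix.of_apply, Matrix.transpose_apply, mul_ite, mul_one,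
    mul_zero]
  rw [Finset.sum_ite_eq, if_pos (Finset.mem_univ _)]

lemma tensorPow_mulVec_codeTensor (hN : Even N) {C : BinaryCode N} (hC : IsSelfDual C)
    {g : Matrix.orthogonalGroup (Fin m → ZMod 2) ℝ} (hg : g ∈ cliffordGroup m) :
    (tensorPow N (g : Matrix _ _ ℝ)).mulVec (codeTensor m C) = codeTensor m C := by
  obtain ⟨k, rfl⟩ := hN
  set t := (tensorPow (k + k) (g : Matrix _ _ ℝ)).mulVec (codeTensor m C) with ht
  have hfix : t = t 0 • codeTensor m C := by
    refine eq_smul_codeTensor hC fun e he c hc => ?_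
    have he' : g⁻¹ * e * g ∈ extraspecialGroup m := (Subgroup.mem_normalizer_iff''.1 hg e).1 he
    -- Moving e past the tensor power of g replaces it by its conjugate on the support of c; the
    -- other factors are unaffected.
    have hcomm : supportKron (e : Matrix _ _ ℝ) c * tensorPow (k + k) (g : Matrix _ _ ℝ) =
        tensorPow (k + k) (g : Matrix _ _ ℝ) *
          supportKron (Subtype.val (g⁻¹ * e * g)) c := by
      rw [supportKron, supportKron, kron_mul_kron, kron_mul_kron]
      congr 1
      ext1 i
      split_ifs
      · rw [one_mul, mul_one]
      · exact congrArg Subtype.val (show e * g = g * (g⁻¹ * e * g) by group)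
    rw [ht, Matrix.mulVec_mulVec, hcomm, ← Matrix.mulVec_mulVec,
      supportKron_mulVec_codeTensor hC.le he' hc]
  -- Both tensors are nonnegative and both take the value 1 at the zero word.
  have hpos : 0 < codeTensor m C ⬝ᵥ pairTensor m k := by
    refine Finset.sum_pos' (fun v _ => ?_) ⟨0, Finset.mem_univ _, ?_⟩
    · refine mul_nonneg ?_ ?_
      · unfold codeTensor
        split_ifs <;> norm_num
      · unfold pairTensor
        split_ifs <;> norm_num
    · rw [codeTensor_of_mem (zero_mem _)]
      simp [pairTensor]
  have hinner := tensorPow_dotProduct g (codeTensor m C) (pairTensor m k)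
  rw [tensorPow_mulVec_pairTensor, ← ht, hfix, smul_dotProduct, smul_eq_mul] at hinner
  have hone : t 0 = 1 := mul_right_cancel₀ hpos.ne' (by rw [hinner, one_mul])
  rw [hfix, hone, one_smul]

/-! ### Character sums -/

open Classical in
-- Translation by an element where φ is nonzero negates the sum.
lemma sum_parity_addMonoidHom {G : Type*} [AddGroup G] [Fintype G] (φ : G →+ ZMod 2) :
    ∑ x, parity (φ x) = if φ = 0 then (Fintype.card G : ℝ) else 0 := by
  split_ifs with h
  · simp [h]
  · obtain ⟨y, hy⟩ : ∃ y, φ y ≠ 0 := by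
      by_contra! hy
      exact h (AddMonoidHom.ext hy)
    have hy1 := (zmod_two_cases _).resolve_left hy
    have hsum := Equiv.sum_comp (Equiv.addRight y) fun x => parity (φ x)
    simp only [Equiv.coe_addRight, map_add, parity_add, hy1, parity_one, mul_neg, mul_one,
      Finset.sum_neg_distrib] at hsum
    linarith

/-- The pairing with `x` as an additive map. -/
def dotHom (x : Fin N → ZMod 2) : (Fin N → ZMod 2) →+ ZMod 2 where
  toFun c := c ⬝ᵥ x
  map_zero' := zero_dotProduct x
  map_add' c d := add_dotProduct c d x

open Classical in
lemma sum_parity_code (C : BinaryCode N) (x : Fin N → ZMod 2) :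
    ∑ c : C, parity ((c : Fin N → ZMod 2) ⬝ᵥ x) =
      if x ∈ dualCode C then (Nat.card C : ℝ) else 0 := by
  have h := sum_parity_addMonoidHom ((dotHom x).comp C.subtype.toAddMonoidHom)
  have hiff : (dotHom x).comp C.subtype.toAddMonoidHom = 0 ↔ x ∈ dualCode C := by
    rw [DFunLike.ext_iff]
    exact ⟨fun h c hc => h ⟨c, hc⟩, fun h c => h c c.2⟩
  simp only [hiff] at h
  rw [Nat.card_eq_fintype_card]
  exact h

/-- The double sum of (-1)^(c·x) over c in C and all x is evaluated in both orders. -/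
lemma card_mul_card_dualCode (C : BinaryCode N) :
    Nat.card C * Nat.card (dualCode C) = 2 ^ N := by
  classical
  have h1 : ∑ x : Fin N → ZMod 2, ∑ c : C, parity ((c : Fin N → ZMod 2) ⬝ᵥ x) =
      (Nat.card (dualCode C) : ℝ) * Nat.card C := by
    simp_rw [sum_parity_code]
    rw [← Finset.sum_filter, Finset.sum_const, nsmul_eq_mul,
      Nat.card_eq_fintype_card (α := dualCode C), Fintype.card_subtype]
  have h2 : ∀ c : C, ∑ x : Fin N → ZMod 2, parity ((c : Fin N → ZMod 2) ⬝ᵥ x) =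
      if c = 0 then (2 : ℝ) ^ N else 0 := by
    intro c
    have h := sum_parity_addMonoidHom (dotHom (c : Fin N → ZMod 2))
    have hiff : dotHom (c : Fin N → ZMod 2) = 0 ↔ c = 0 := by
      constructor
      · intro h0
        refine Subtype.ext (funext fun j => ?_)
        simpa [dotHom] using DFunLike.congr_fun h0 (Pi.single j 1)
      · rintro rfl
        ext
        simp [dotHom]
    simp only [hiff, Fintype.card_fun, ZMod.card, Fintype.card_fin, Nat.cast_pow,
      Nat.cast_ofNat] at h
    simp only [dotHom, AddMonoidHom.coe_mk, ZeroHom.coe_mk] at h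
    simpa only [dotProduct_comm] using h
  rw [Finset.sum_comm] at h1
  simp_rw [h2] at h1
  rw [Finset.sum_ite_eq' Finset.univ (0 : C), if_pos (Finset.mem_univ _)] at h1
  rw [mul_comm]
  exact_mod_cast h1.symm

/-! ### The partial Hadamard transform of an indicator tensor -/

lemma tensorPow_hadamard_mulVec (a b : Fin m → ZMod 2) (t : (Fin N → Fin m → ZMod 2) → ℝ)
    (w : Fin N → Fin m → ZMod 2) :
    (tensorPow N (hadamard a b)).mulVec t w = (Real.sqrt 2)⁻¹ ^ N *
      ∑ x : Fin N → ZMod 2, parity ((1 + x) ⬝ᵥ contract b w) * t (w + outer a x) := by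
  -- Each factor selects Z_b (y = 0) or X_a (y = 1); the N choices form the word x.
  have h1 : ∀ _ : Fin N, shiftMat a + signMat b =
      ∑ y : ZMod 2, signMat ((1 + y) • b) * shiftMat (y • a) := by
    intro _
    have huniv : (Finset.univ : Finset (ZMod 2)) = {0, 1} := by decide
    rw [huniv, Finset.sum_pair (by decide)]
    simp [show (1 : ZMod 2) + 1 = 0 by decide, signMat_zero, shiftMat_zero, add_comm]
  simp only [tensorPow, hadamard]
  rw [kron_smul, Fintype.card_fin, Matrix.smul_mulVec, Pi.smul_apply, smul_eq_mul,
    show (fun _ : Fin N => shiftMat a + signMat b) = _ from funext h1, kron_sum,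
    Matrix.sum_mulVec, Finset.sum_apply]
  congr 1
  refine Finset.sum_congr rfl fun x _ => ?_
  rw [← kron_mul_kron (fun i => signMat ((1 + x i) • b)) (fun i => shiftMat (x i • a)),
    ← Matrix.mulVec_mulVec, kron_shiftMat_mulVec, kron_signMat_mulVec]
  refine congrArg₂ _ (congrArg parity ?_) rfl
  simp [dotProduct, contract, Finset.mul_sum, mul_assoc]

lemma one_add_dotProduct_self (x : Fin N → ZMod 2) : (1 + x) ⬝ᵥ x = 0 := by
  have : ∀ y : ZMod 2, (1 + y) * y = 0 := by decide
  exact Finset.sum_eq_zero fun i _ => this (x i)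

open Classical in
-- Averaging the summand over translations of x by C leaves only x in C^⊥, by orthogonality of
-- characters. There the remaining sign is trivial because 1 lies in C.
lemma tensorPow_hadamard_mulVec_codeTensor {C : BinaryCode N} (hC : IsSelfOrthogonal C)
    (hone : (1 : Fin N → ZMod 2) ∈ C) {a b : Fin m → ZMod 2} (hab : b ⬝ᵥ a = 1) :
    (tensorPow N (hadamard a b)).mulVec (codeTensor m C) = (Real.sqrt 2)⁻¹ ^ N •
      ∑ x : Fin N → ZMod 2 with x ∈ dualCode C, fun w => codeTensor m C (w + outer a x) := by
  ext w
  rw [tensorPow_hadamard_mulVec, Pi.smul_apply, smul_eq_mul, Finset.sum_apply]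
  congr 1
  set y := contract b w with hy
  have hyx : ∀ x, w + outer a x ∈ powCode m C → y + x ∈ C := by
    intro x hx
    have := contract_mem hx b
    rwa [contract_add_outer, hab, one_smul] at this
  set f : (Fin N → ZMod 2) → ℝ := fun x =>
    parity ((1 + x) ⬝ᵥ y) * codeTensor m C (w + outer a x) with hf
  -- Where the indicator is nonzero, y + x lies in C, so c·y = c·x for every c in C.
  have hshift : ∀ x, ∀ c ∈ C, f (x + c) = f x * parity (c ⬝ᵥ x) := by
    intro x c hc
    simp only [hf]
    rw [outer_add, ← add_assoc w, codeTensor_add_of_mem (outer_mem_powCode hc a)]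
    by_cases hx : w + outer a x ∈ powCode m C
    · have h0 : c ⬝ᵥ y + c ⬝ᵥ x = 0 := by
        rw [← dotProduct_add]
        exact hC (hyx x hx) c hc
      have h1 : c ⬝ᵥ y = c ⬝ᵥ x := by
        rw [← add_zero (c ⬝ᵥ y), ← h0, ← add_assoc, CharTwo.add_self_eq_zero, zero_add]
      rw [← add_assoc, add_dotProduct, parity_add, h1]
      ring
    · rw [codeTensor_of_notMem hx]
      ring
  -- Here 1 + x lies in C^⊥ and y + x in C, so (1 + x)·(y + x) = 0, while (1 + x)·x = 0 always
  -- holds.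
  have hdual : ∀ x ∈ dualCode C, f x = codeTensor m C (w + outer a x) := by
    intro x hx
    simp only [hf]
    by_cases hxw : w + outer a x ∈ powCode m C
    · have h0 : (1 + x) ⬝ᵥ y = 0 := by
        have h1 : (1 + x) ⬝ᵥ (y + x) = 0 := by
          rw [dotProduct_comm]
          exact (dualCode C).add_mem (hC hone) hx _ (hyx x hxw)
        rwa [dotProduct_add, one_add_dotProduct_self, add_zero] at h1
      rw [h0, parity_zero, one_mul]
    · rw [codeTensor_of_notMem hxw, mul_zero]
  have hcard : (Nat.card C : ℝ) ≠ 0 := by exact_mod_cast Nat.card_pos.ne'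
  refine mul_left_cancel₀ hcard ?_
  calc (Nat.card C : ℝ) * ∑ x, f x = ∑ c : C, ∑ x, f (x + c) := by
        have hc : ∀ c : C, ∑ x, f (x + c) = ∑ x, f x := fun c =>
          Equiv.sum_comp (Equiv.addRight (c : Fin N → ZMod 2)) f
        rw [Finset.sum_congr rfl fun c _ => hc c, Finset.sum_const, nsmul_eq_mul,
          Finset.card_univ, Nat.card_eq_fintype_card]
    _ = ∑ x, f x * ∑ c : C, parity ((c : Fin N → ZMod 2) ⬝ᵥ x) := by
        rw [Finset.sum_comm]
        refine Finset.sum_congr rfl fun x _ => ?_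
        rw [Finset.mul_sum]
        exact Finset.sum_congr rfl fun c _ => hshift x c c.2
    _ = ∑ x with x ∈ dualCode C, f x * Nat.card C := by
        simp_rw [sum_parity_code, mul_ite, mul_zero]
        rw [Finset.sum_filter]
    _ = _ := by
        rw [Finset.mul_sum]
        refine Finset.sum_congr rfl fun x hx => ?_
        rw [hdual x (Finset.mem_filter.1 hx).2, mul_comm]

end Tensor

section Average

variable {m N : ℕ}

/-! ### Extending a code by one word -/

lemma mem_sup_span_singleton_iff {C : BinaryCode N} {x y : Fin N → ZMod 2} :
    y ∈ C ⊔ Submodule.span (ZMod 2) {x} ↔ y ∈ C ∨ y + x ∈ C := by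
  rw [Submodule.mem_sup]
  constructor
  · rintro ⟨c, hc, z, hz, rfl⟩
    obtain ⟨s, rfl⟩ := Submodule.mem_span_singleton.1 hz
    rcases zmod_two_cases s with rfl | rfl
    · left
      simpa using hc
    · right
      rwa [one_smul, add_assoc, add_self_eq_zero_of_module, add_zero]
  · rintro (h | h)
    · exact ⟨y, h, 0, zero_mem _, add_zero y⟩
    · exact ⟨y + x, h, x, Submodule.mem_span_singleton_self x,
        by rw [add_assoc, add_self_eq_zero_of_module, add_zero]⟩

open Classical in
lemma indicator_sup_span_singleton {C : BinaryCode N} {x : Fin N → ZMod 2} (hx : x ∉ C)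
    (y : Fin N → ZMod 2) :
    (if y ∈ C ⊔ Submodule.span (ZMod 2) {x} then (1 : ℝ) else 0) =
      ∑ s : ZMod 2, if y + s • x ∈ C then 1 else 0 := by
  have huniv : (Finset.univ : Finset (ZMod 2)) = {0, 1} := by decide
  rw [huniv, Finset.sum_pair (by decide), zero_smul, one_smul, add_zero]
  by_cases h1 : y ∈ C <;> by_cases h2 : y + x ∈ C
  · exact absurd ((Submodule.add_mem_iff_right C h1).1 h2) hx
  all_goals simp [mem_sup_span_singleton_iff, h1, h2]

lemma card_sup_span_singleton {C : BinaryCode N} {x : Fin N → ZMod 2} (hx : x ∉ C) :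
    Nat.card (C ⊔ Submodule.span (ZMod 2) {x} : BinaryCode N) = 2 * Nat.card C := by
  classical
  have hcard : ∀ D : BinaryCode N, (Nat.card D : ℝ) = ∑ y, if y ∈ D then 1 else 0 := by
    intro D
    rw [Finset.sum_boole, Nat.card_eq_fintype_card, Fintype.card_subtype]
  have h : (Nat.card (C ⊔ Submodule.span (ZMod 2) {x} : BinaryCode N) : ℝ) = 2 * Nat.card C := by
    rw [hcard, Finset.sum_congr rfl fun y _ => indicator_sup_span_singleton hx y,
      Finset.sum_comm]
    have hs : ∀ s : ZMod 2, ∑ y, (if y + s • x ∈ C then (1 : ℝ) else 0) = Nat.card C := by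
      intro s
      rw [hcard]
      exact Equiv.sum_comp (Equiv.addRight (s • x)) fun y => if y ∈ C then (1 : ℝ) else 0
    simp [hs]
  exact_mod_cast h

/-- Each of the m rows lies in C or in C + x, exclusively. Expanding the product of these choices
gives a sum over a in 𝔽₂^m. -/
lemma codeTensor_sup_span_singleton {C : BinaryCode N} {x : Fin N → ZMod 2} (hx : x ∉ C)
    (w : Fin N → Fin m → ZMod 2) :
    codeTensor m (C ⊔ Submodule.span (ZMod 2) {x}) w =
      ∑ a : Fin m → ZMod 2, codeTensor m C (w + outer a x) := by
  classical
  have hprod : ∀ (D : BinaryCode N) (v : Fin N → Fin m → ZMod 2),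
      codeTensor m D v = ∏ j, if (fun i => v i j) ∈ D then 1 else 0 := by
    intro D v
    rw [Finset.prod_ite_zero]
    simp [codeTensor, mem_powCode]
  simp_rw [hprod, indicator_sup_span_singleton hx]
  rw [Finset.prod_univ_sum, Fintype.piFinset_univ]
  refine Finset.sum_congr rfl fun a _ => Finset.prod_congr rfl fun j _ => ?_
  congr 2
  ext i
  simp [outer, mul_comm]

/-- Over 𝔽₂, x·x = 1·x. Hence adjoining any x in C^⊥ preserves self-orthogonality. -/
lemma dotProduct_self_of_mem_dualCode {C : BinaryCode N} (hone : (1 : Fin N → ZMod 2) ∈ C)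
    {x : Fin N → ZMod 2} (hx : x ∈ dualCode C) : x ⬝ᵥ x = 0 := by
  have h := one_add_dotProduct_self x
  rwa [add_dotProduct, hx 1 hone, zero_add] at h

lemma isSelfOrthogonal_sup_span_singleton {C : BinaryCode N} (hC : IsSelfOrthogonal C)
    (hone : (1 : Fin N → ZMod 2) ∈ C) {x : Fin N → ZMod 2} (hx : x ∈ dualCode C) :
    IsSelfOrthogonal (C ⊔ Submodule.span (ZMod 2) {x}) := by
  have hx' : ∀ c ∈ C, x ⬝ᵥ c = 0 := fun c hc => by rw [dotProduct_comm, hx c hc]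
  have hxx := dotProduct_self_of_mem_dualCode hone hx
  intro y hy z hz
  obtain ⟨c, hc, u, hu, rfl⟩ := Submodule.mem_sup.1 hy
  obtain ⟨d, hd, v, hv, rfl⟩ := Submodule.mem_sup.1 hz
  obtain ⟨s, rfl⟩ := Submodule.mem_span_singleton.1 hu
  obtain ⟨s', rfl⟩ := Submodule.mem_span_singleton.1 hv
  simp [add_dotProduct, dotProduct_add, hC hc d hd, hx d hd, hx' c hc, hxx]

/-! ### Inclusions and sizes of self-dual codes -/

lemma dualCode_anti {C D : BinaryCode N} (h : C ≤ D) : dualCode D ≤ dualCode C :=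
  fun _ hx c hc => hx c (h hc)

lemma eq_of_isSelfDual_of_le {C D : BinaryCode N} (hC : IsSelfDual C) (hD : IsSelfDual D)
    (h : C ≤ D) : D = C := by
  refine le_antisymm ?_ h
  rw [hD, hC]
  exact dualCode_anti h

lemma sq_card_of_isSelfDual {C : BinaryCode N} (hC : IsSelfDual C) : Nat.card C ^ 2 = 2 ^ N := by
  have h := card_mul_card_dualCode C
  rwa [← show C = dualCode C from hC, ← sq] at h

lemma isSelfDual_of_sq_card {C : BinaryCode N} (hC : IsSelfOrthogonal C)
    (h : Nat.card C ^ 2 = 2 ^ N) : IsSelfDual C := by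
  refine SetLike.coe_injective (Set.eq_of_subset_of_ncard_le hC ?_)
  rw [← card_mul_card_dualCode C, sq] at h
  exact (Nat.eq_of_mul_eq_mul_left Nat.card_pos h).ge

/-! ### Averaging over the Clifford group -/

/-- The average of a tensor over the Clifford group. -/
def average (m N : ℕ) :
    ((Fin N → Fin m → ZMod 2) → ℝ) →ₗ[ℝ] ((Fin N → Fin m → ZMod 2) → ℝ) :=
  let _ := Fintype.ofFinite (cliffordGroup m)
  (Nat.card (cliffordGroup m) : ℝ)⁻¹ •
    ∑ g : cliffordGroup m, (tensorPow N (g : Matrix.orthogonalGroup _ ℝ).1).mulVecLin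

lemma average_apply [Fintype (cliffordGroup m)] (t : (Fin N → Fin m → ZMod 2) → ℝ) :
    average m N t = (Nat.card (cliffordGroup m) : ℝ)⁻¹ •
      ∑ g : cliffordGroup m, (tensorPow N (g : Matrix.orthogonalGroup _ ℝ).1).mulVec t := by
  simp only [average, LinearMap.smul_apply, LinearMap.sum_apply, Matrix.mulVecLin_apply]
  congr!

lemma average_tensorPow_mulVec {h : Matrix.orthogonalGroup (Fin m → ZMod 2) ℝ}
    (hh : h ∈ cliffordGroup m) (t : (Fin N → Fin m → ZMod 2) → ℝ) :
    average m N ((tensorPow N h.1).mulVec t) = average m N t := by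
  let _ := Fintype.ofFinite (cliffordGroup m)
  rw [average_apply, average_apply]
  congr 1
  rw [← Equiv.sum_comp (Equiv.mulRight (⟨h, hh⟩ : cliffordGroup m))
    fun g : cliffordGroup m => (tensorPow N (g : Matrix.orthogonalGroup _ ℝ).1).mulVec t]
  refine Finset.sum_congr rfl fun g _ => ?_
  rw [Matrix.mulVec_mulVec, kron_mul_kron]
  rfl

lemma average_codeTensor_of_isSelfDual (hN : Even N) {C : BinaryCode N} (hC : IsSelfDual C) :
    average m N (codeTensor m C) = codeTensor m C := by
  let _ := Fintype.ofFinite (cliffordGroup m)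
  rw [average_apply,
    Finset.sum_congr rfl fun g _ => tensorPow_mulVec_codeTensor hN hC (Subtype.prop g),
    Finset.sum_const, Finset.card_univ, ← Nat.card_eq_fintype_card, ← Nat.cast_smul_eq_nsmul ℝ,
    smul_smul, inv_mul_cancel₀ (by exact_mod_cast Nat.card_pos.ne'), one_smul]

lemma inv_sqrt_two_pow (k : ℕ) : (Real.sqrt 2)⁻¹ ^ (k + k) = ((2 : ℝ) ^ k)⁻¹ := by
  rw [pow_add, ← mul_pow, inv_sqrt_two_mul_self, inv_pow]

open Classical in
-- The average is unchanged by inserting a reflection. A unit vector at a nonzero coordinate of a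
-- serves as b.
lemma average_codeTensor_eq_of_ne_zero {k : ℕ} {C : BinaryCode (k + k)}
    (hC : IsSelfOrthogonal C) (hone : (1 : Fin (k + k) → ZMod 2) ∈ C) {a : Fin m → ZMod 2}
    (ha : a ≠ 0) :
    average m (k + k) (codeTensor m C) = ((2 : ℝ) ^ k)⁻¹ •
      ∑ x : Fin (k + k) → ZMod 2 with x ∈ dualCode C,
        average m (k + k) fun w => codeTensor m C (w + outer a x) := by
  obtain ⟨j, hj⟩ := Function.ne_iff.1 ha
  have hab : (Pi.single j 1 : Fin m → ZMod 2) ⬝ᵥ a = 1 := by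
    rw [single_one_dotProduct]
    exact (zmod_two_cases _).resolve_left hj
  rw [← average_tensorPow_mulVec (hadamardO_mem_cliffordGroup hab)]
  change average m (k + k) ((tensorPow (k + k) (hadamard a _)).mulVec _) = _
  rw [tensorPow_hadamard_mulVec_codeTensor hC hone hab, map_smul, map_sum, inv_sqrt_two_pow]

open Classical in
-- For x outside C the sum over all a is the tensor of C + ⟨x⟩; for x in C every translate is
-- trivial. Dropping a = 0 subtracts one copy of the tensor of C.
lemma sum_codeTensor_add_outer (C : BinaryCode N) (x : Fin N → ZMod 2) :
    ∑ a : Fin m → ZMod 2 with a ≠ 0, (fun w => codeTensor m C (w + outer a x)) =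
      if x ∈ C then ((2 : ℝ) ^ m - 1) • codeTensor m C
      else codeTensor m (C ⊔ Submodule.span (ZMod 2) {x}) - codeTensor m C := by
  have hzero : (fun w => codeTensor m C (w + outer 0 x)) = codeTensor m C := by
    ext w
    rw [show outer (0 : Fin m → ZMod 2) x = 0 by ext; simp [outer], add_zero]
  have hsum : ∑ a : Fin m → ZMod 2 with a ≠ 0, (fun w => codeTensor m C (w + outer a x)) =
      ∑ a : Fin m → ZMod 2, (fun w => codeTensor m C (w + outer a x)) - codeTensor m C := by
    rw [Finset.filter_ne', ← Finset.add_sum_erase _ _ (Finset.mem_univ (0 : Fin m → ZMod 2)),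
      hzero, add_sub_cancel_left]
  rw [hsum]
  split_ifs with hx
  · ext w
    simp [codeTensor_add_of_mem (outer_mem_powCode hx _), sub_mul]
  · ext w
    simp [codeTensor_sup_span_singleton hx]

open Classical in
-- This is the reflection identity summed over the 2^m - 1 nonzero a, with C^⊥ split into C and its
-- complement.
lemma average_codeTensor_recursion {k : ℕ} {C : BinaryCode (k + k)}
    (hC : IsSelfOrthogonal C) (hone : (1 : Fin (k + k) → ZMod 2) ∈ C) :
    ((2 : ℝ) ^ m - 1) • average m (k + k) (codeTensor m C) = ((2 : ℝ) ^ k)⁻¹ •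
      ((Nat.card C * ((2 : ℝ) ^ m - 1)) • average m (k + k) (codeTensor m C) +
        ∑ x : Fin (k + k) → ZMod 2 with x ∈ dualCode C ∧ x ∉ C,
          (average m (k + k) (codeTensor m (C ⊔ Submodule.span (ZMod 2) {x})) -
            average m (k + k) (codeTensor m C))) := by
  have hcard : ((Finset.univ.filter fun a : Fin m → ZMod 2 => a ≠ 0).card : ℝ) = 2 ^ m - 1 := by
    rw [Finset.filter_ne', Finset.card_erase_of_mem (Finset.mem_univ _), Finset.card_univ,
      Nat.cast_sub Fintype.card_pos]
    simp
  have h1 : ∑ a : Fin m → ZMod 2 with a ≠ 0, average m (k + k) (codeTensor m C) =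
      ((2 : ℝ) ^ m - 1) • average m (k + k) (codeTensor m C) := by
    rw [Finset.sum_const, ← Nat.cast_smul_eq_nsmul ℝ, hcard]
  rw [← h1, Finset.sum_congr rfl fun a ha =>
    average_codeTensor_eq_of_ne_zero hC hone (Finset.mem_filter.1 ha).2, ← Finset.smul_sum,
    Finset.sum_comm]
  congr 1
  simp_rw [← map_sum, sum_codeTensor_add_outer]
  rw [← Finset.sum_filter_add_sum_filter_not _ (fun x => x ∈ C), Finset.filter_filter,
    Finset.filter_filter, map_add]
  congr 1
  · have hf : (Finset.univ.filter fun x : Fin (k + k) → ZMod 2 => x ∈ dualCode C ∧ x ∈ C) =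
        Finset.univ.filter fun x => x ∈ C :=
      Finset.filter_congr fun x _ => and_iff_right_of_imp fun hx => hC hx
    rw [hf, Finset.sum_congr rfl fun x hx => by rw [if_pos (Finset.mem_filter.1 hx).2],
      Finset.sum_const, ← Nat.cast_smul_eq_nsmul ℝ, map_smul, map_smul, smul_smul,
      Nat.card_eq_fintype_card, Fintype.card_subtype]
  · rw [map_sum]
    refine Finset.sum_congr rfl fun x hx => ?_
    rw [if_neg (Finset.mem_filter.1 hx).2.2, map_sub]

/-! ### Self-dual codes above a given code, and the induction -/

instance fintypeBinaryCode : Fintype (BinaryCode N) := Fintype.ofFinite _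

open Classical in
-- Each C' arises once for every x in C' outside C. Such x lie in C^⊥ automatically, since C' is
-- self-dual.
lemma sum_sum_selfDual_sup_span_singleton {k : ℕ} {M : Type*} [AddCommGroup M] [Module ℝ M]
    {C : BinaryCode (k + k)} (f : BinaryCode (k + k) → M) :
    ∑ x : Fin (k + k) → ZMod 2 with x ∈ dualCode C ∧ x ∉ C,
      ∑ C' : BinaryCode (k + k) with IsSelfDual C' ∧ C ⊔ Submodule.span (ZMod 2) {x} ≤ C', f C' =
    ((2 : ℝ) ^ k - Nat.card C) • ∑ C' : BinaryCode (k + k) with IsSelfDual C' ∧ C ≤ C', f C' := by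
  rw [Finset.smul_sum, Finset.sum_comm' (t' := Finset.univ.filter fun C' => IsSelfDual C' ∧ C ≤ C')
    (s' := fun C' => Finset.univ.filter fun x => x ∈ C' ∧ x ∉ C)]
  · refine Finset.sum_congr rfl fun C' hC' => ?_
    obtain ⟨-, hsd, hle⟩ := Finset.mem_filter.1 hC'
    have hk : Nat.card C' = 2 ^ k := by
      have h := sq_card_of_isSelfDual hsd
      rw [pow_add, ← sq] at h
      exact Nat.pow_left_injective (n := 2) (by norm_num) h
    rw [Finset.sum_const, ← Nat.cast_smul_eq_nsmul ℝ]
    congr 1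
    have h := Finset.card_filter_add_card_filter_not (s := Finset.univ.filter fun x => x ∈ C')
      fun x => x ∈ C
    rw [Finset.filter_filter, Finset.filter_filter,
      show (Finset.univ.filter fun x => x ∈ C' ∧ x ∈ C) = Finset.univ.filter fun x => x ∈ C from
        Finset.filter_congr fun x _ => and_iff_right_of_imp fun hx => hle hx,
      ← Fintype.card_subtype (fun x => x ∈ C), ← Fintype.card_subtype (fun x => x ∈ C')] at h
    rw [Nat.card_eq_fintype_card] at hk ⊢
    rw [eq_sub_iff_add_eq, add_comm]
    rw [hk] at h
    exact_mod_cast h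
  · intro x C'
    simp only [Finset.mem_filter, Finset.mem_univ, true_and, sup_le_iff,
      Submodule.span_singleton_le_iff_mem]
    constructor
    · rintro ⟨⟨-, hx⟩, hsd, hle, hx'⟩
      exact ⟨⟨hx', hx⟩, hsd, hle⟩
    · rintro ⟨⟨hx', hx⟩, hsd, hle⟩
      refine ⟨⟨dualCode_anti hle ?_, hx⟩, hsd, hle, hx'⟩
      rwa [← show C' = dualCode C' from hsd]

open Classical in
theorem average_codeTensor {k r : ℕ} {C : BinaryCode (k + k)} (hC : IsSelfOrthogonal C)
    (hone : (1 : Fin (k + k) → ZMod 2) ∈ C) (hcard : Nat.card C * 2 ^ r = 2 ^ k) :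
    average m (k + k) (codeTensor m C) = (∏ i ∈ Finset.Icc 1 r, ((2 : ℝ) ^ m + 2 ^ i)⁻¹) •
      ∑ C' : BinaryCode (k + k) with IsSelfDual C' ∧ C ≤ C', codeTensor m C' := by
  induction r generalizing C with
  | zero =>
    have hsd : IsSelfDual C := by
      refine isSelfDual_of_sq_card hC ?_
      rw [pow_zero, mul_one] at hcard
      rw [hcard, sq, pow_add]
    have hf : (Finset.univ.filter fun C' : BinaryCode (k + k) => IsSelfDual C' ∧ C ≤ C') = {C} := by
      ext C'
      simp only [Finset.mem_filter, Finset.mem_univ, true_and, Finset.mem_singleton]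
      refine ⟨fun h => eq_of_isSelfDual_of_le hsd h.1 h.2, ?_⟩
      rintro rfl
      exact ⟨hsd, le_rfl⟩
    rw [hf, Finset.sum_singleton, average_codeTensor_of_isSelfDual ⟨k, rfl⟩ hsd]
    simp
  | succ r ih =>
    set P := average m (k + k) (codeTensor m C) with hP
    set S := ∑ C' : BinaryCode (k + k) with IsSelfDual C' ∧ C ≤ C', codeTensor m C' with hS
    set D : ℝ := (Nat.card C : ℝ) with hD
    set κ : ℝ := ∏ i ∈ Finset.Icc 1 r, ((2 : ℝ) ^ m + 2 ^ i)⁻¹ with hκ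
    have hDpos : 0 < D := by
      rw [hD]
      exact_mod_cast Nat.card_pos
    have hDk : (2 : ℝ) ^ k = D * 2 ^ (r + 1) := by
      rw [hD]
      exact_mod_cast hcard.symm
    have hrec := average_codeTensor_recursion (m := m) hC hone
    have hx : ∀ x ∈ Finset.univ.filter fun x : Fin (k + k) → ZMod 2 => x ∈ dualCode C ∧ x ∉ C,
        average m (k + k) (codeTensor m (C ⊔ Submodule.span (ZMod 2) {x})) = κ •
          ∑ C' : BinaryCode (k + k) with
            IsSelfDual C' ∧ C ⊔ Submodule.span (ZMod 2) {x} ≤ C', codeTensor m C' := by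
      intro x hx
      obtain ⟨-, hxd, hxC⟩ := Finset.mem_filter.1 hx
      refine ih (isSelfOrthogonal_sup_span_singleton hC hone hxd)
        (Submodule.mem_sup_left hone) ?_
      -- Adjoining x doubles the code, so the exponent r + 1 drops to r.
      rw [card_sup_span_singleton hxC, ← hcard, pow_succ]
      ring
    have hcount : ((Finset.univ.filter fun x : Fin (k + k) → ZMod 2 =>
        x ∈ dualCode C ∧ x ∉ C).card : ℝ) = D * (2 ^ (r + 1)) ^ 2 - D := by
      have hdual : (Nat.card (dualCode C) : ℝ) = D * (2 ^ (r + 1)) ^ 2 := by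
        have h : D * Nat.card (dualCode C) = 2 ^ (k + k) := by
          rw [hD]
          exact_mod_cast card_mul_card_dualCode C
        refine mul_left_cancel₀ hDpos.ne' ?_
        rw [h, pow_add, hDk]
        ring
      have h := Finset.card_filter_add_card_filter_not
        (s := Finset.univ.filter fun x => x ∈ dualCode C) fun x => x ∈ C
      rw [Finset.filter_filter, Finset.filter_filter,
        show (Finset.univ.filter fun x => x ∈ dualCode C ∧ x ∈ C) =
          Finset.univ.filter fun x => x ∈ C from
            Finset.filter_congr fun x _ => and_iff_right_of_imp fun hx => hC hx,
        ← Fintype.card_subtype (fun x => x ∈ C),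
        ← Fintype.card_subtype (fun x => x ∈ dualCode C)] at h
      rw [← hdual, hD, Nat.card_eq_fintype_card, Nat.card_eq_fintype_card, ← h]
      push_cast
      ring
    rw [Finset.sum_sub_distrib, Finset.sum_congr rfl hx, ← Finset.smul_sum,
      sum_sum_selfDual_sup_span_singleton, Finset.sum_const, ← Nat.cast_smul_eq_nsmul ℝ, hcount,
      ← hP, ← hS, ← hD, hDk] at hrec
    rw [Finset.prod_Icc_succ_top (by omega), ← hκ]
    have hR : (1 : ℝ) < 2 ^ (r + 1) := one_lt_pow₀ (by norm_num) (by omega)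
    have hq : (0 : ℝ) < 2 ^ m := by positivity
    ext w
    have hw := congrFun hrec w
    simp only [Pi.smul_apply, Pi.add_apply, Pi.sub_apply, smul_eq_mul] at hw ⊢
    generalize (2 : ℝ) ^ (r + 1) = R at *
    generalize (2 : ℝ) ^ m = q at *
    have hR1 : R - 1 ≠ 0 := by linarith
    have hR0 : R ≠ 0 := by linarith
    have hqR : q + R ≠ 0 := by linarith
    rw [eq_inv_mul_iff_mul_eq₀ (mul_ne_zero hDpos.ne' hR0)] at hw
    -- With |C| = D, 2^k = DR and |C^⊥| = DR², the recursion reads D(R - 1)((q - 1) + (R + 1))P =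
    -- κD(R - 1)S; the factor D(R - 1) cancels.
    have hmul : (q + R) * P w = κ * S w := by
      refine mul_left_cancel₀ (mul_ne_zero hDpos.ne' hR1) ?_
      linear_combination hw
    rw [mul_right_comm, ← hmul, mul_right_comm, mul_inv_cancel₀ hqR, one_mul]

end Average

section Polynomial

variable {m N : ℕ} {F : Type*} [Field F] [Algebra (ZMod 2) F]

/-! ### From tensors to polynomials -/

/-- Coordinates in b identify C ⊗ F with C^m: multiplication by a scalar of F is 𝔽₂-linear on
coordinates, and conversely c is the combination of its coordinate words with coefficients b_j. -/
lemma mem_extendCode_iff (b : Module.Basis (Fin m) (ZMod 2) F) {C : BinaryCode N}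
    {c : Fin N → F} : c ∈ extendCode F C ↔ (fun i => b.equivFun (c i)) ∈ powCode m C := by
  rw [mem_powCode]
  constructor
  · intro hc
    induction hc using Submodule.span_induction with
    | mem x hx =>
      obtain ⟨y, hy, rfl⟩ := hx
      intro j
      convert! C.smul_mem (b.equivFun 1 j) hy using 1
      ext i
      simp [Algebra.algebraMap_eq_smul_one, mul_comm]
    | zero =>
      intro j
      convert! C.zero_mem using 1
      ext i
      simp
    | add x y _ _ hx hy =>
      intro j
      convert! C.add_mem (hx j) (hy j) using 1
      ext i
      simp
    | smul f x _ hx =>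
      intro j
      convert! C.sum_mem (t := Finset.univ)
        fun l _ => C.smul_mem (b.equivFun (f * b l) j) (hx l) using 1
      ext i
      simp only [Pi.smul_apply, smul_eq_mul, Finset.sum_apply]
      conv_lhs => rw [← b.sum_equivFun (x i), Finset.mul_sum]
      simp [mul_comm]
  · intro h
    have hc : c = ∑ j, b j • fun i => algebraMap (ZMod 2) F (b.equivFun (c i) j) := by
      ext i
      conv_lhs => rw [← b.sum_equivFun (c i)]
      simp [Finset.sum_apply, Algebra.smul_def, mul_comm]
    rw [hc]
    exact Submodule.sum_mem _ fun j _ => Submodule.smul_mem _ _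
      (Submodule.subset_span ⟨_, h j, rfl⟩)

variable [Fintype F]

/-- The polynomial `∑_c t_c ∏_i x_{c_i}` attached to a tensor `t`. -/
def tensorPoly (b : Module.Basis (Fin m) (ZMod 2) F) :
    ((Fin N → Fin m → ZMod 2) → ℝ) →ₗ[ℝ] MvPolynomial F ℝ where
  toFun t := ∑ c : Fin N → F, t (fun i => b.equivFun (c i)) • ∏ i, MvPolynomial.X (c i)
  map_add' s t := by simp [add_smul, Finset.sum_add_distrib]
  map_smul' a t := by simp [mul_smul, Finset.smul_sum]

lemma tensorPoly_apply (b : Module.Basis (Fin m) (ZMod 2) F)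
    (t : (Fin N → Fin m → ZMod 2) → ℝ) : tensorPoly b t =
      ∑ c : Fin N → F, t (fun i => b.equivFun (c i)) • ∏ i, MvPolynomial.X (c i) := rfl

lemma cwe_extendCode (b : Module.Basis (Fin m) (ZMod 2) F) (C : BinaryCode N) :
    cwe (extendCode F C) = tensorPoly b (codeTensor m C) := by
  classical
  rw [cwe, Finset.sum_filter, tensorPoly_apply]
  refine Finset.sum_congr rfl fun c _ => ?_
  rw [mem_extendCode_iff b, codeTensor, ite_smul, one_smul, zero_smul]
  congr 1
  rw [← Finset.prod_fiberwise' Finset.univ c fun f => (MvPolynomial.X f : MvPolynomial F ℝ)]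
  refine Finset.prod_congr rfl fun f _ => ?_
  rw [Finset.prod_const]

/-- Passing from tensors to the symmetric power is equivariant: expanding the product of the
substituted linear forms produces the tensor power of g. -/
lemma polyAction_tensorPoly (b : Module.Basis (Fin m) (ZMod 2) F)
    (g : Matrix (Fin m → ZMod 2) (Fin m → ZMod 2) ℝ) (t : (Fin N → Fin m → ZMod 2) → ℝ) :
    polyAction b g (tensorPoly b t) = tensorPoly b ((tensorPow N g).mulVec t) := by
  classical
  have hX : ∀ c : Fin N → F, polyAction b g (∏ i, MvPolynomial.X (c i)) =
      ∑ d : Fin N → F, (∏ i, g (b.equivFun (d i)) (b.equivFun (c i))) •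
        ∏ i, (MvPolynomial.X (d i) : MvPolynomial F ℝ) := by
    intro c
    simp only [map_prod, polyAction, MvPolynomial.aeval_X]
    rw [Finset.prod_univ_sum, Fintype.piFinset_univ]
    exact Finset.sum_congr rfl fun d _ => Finset.prod_smul _ _ _
  rw [tensorPoly_apply, tensorPoly_apply, map_sum]
  simp_rw [map_smul, hX, Finset.smul_sum]
  rw [Finset.sum_comm]
  refine Finset.sum_congr rfl fun d _ => ?_
  simp_rw [smul_smul, ← Finset.sum_smul]
  congr 1
  rw [Matrix.mulVec, dotProduct,
    ← Equiv.sum_comp (Equiv.arrowCongr (Equiv.refl (Fin N)) b.equivFun.toEquiv)]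
  refine Finset.sum_congr rfl fun c _ => ?_
  rw [mul_comm]
  rfl

end Polynomial

end CliffordAverage

end

/-! ### The identity for complete weight enumerators -/

theorem mainTheorem2 {m : ℕ} {F : Type*} [Field F] [Fintype F] [Algebra (ZMod 2) F]
    (b : Module.Basis (Fin m) (ZMod 2) F)
    {N r : ℕ} (hN : Even N) (C : CliffordAverage.BinaryCode N)
    (hC : CliffordAverage.IsSelfOrthogonal C)
    (hone : (1 : Fin N → ZMod 2) ∈ C)
    (hdim : Module.finrank (ZMod 2) C + r = N / 2) :
    Finite (CliffordAverage.cliffordGroup m) ∧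
    (Nat.card (CliffordAverage.cliffordGroup m) : ℝ)⁻¹ •
        ∑ᶠ g : CliffordAverage.cliffordGroup m,
          CliffordAverage.polyAction b
            ((g : Matrix.orthogonalGroup (Fin m → ZMod 2) ℝ) :
              Matrix (Fin m → ZMod 2) (Fin m → ZMod 2) ℝ)
            (CliffordAverage.cwe (CliffordAverage.extendCode F C)) =
      (∏ i ∈ Finset.Icc 1 r, ((2 : ℝ) ^ m + 2 ^ i)⁻¹) •
        ∑ᶠ (C' : CliffordAverage.BinaryCode N)
          (_ : CliffordAverage.IsSelfDual C' ∧ C ≤ C'),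
          CliffordAverage.cwe (CliffordAverage.extendCode F C') := by
  classical
  refine ⟨CliffordAverage.finite_cliffordGroup, ?_⟩
  let _ := Fintype.ofFinite (CliffordAverage.cliffordGroup m)
  obtain ⟨k, rfl⟩ := hN
  have hcard : Nat.card C * 2 ^ r = 2 ^ k := by
    rw [Module.natCard_eq_pow_finrank (K := ZMod 2), Nat.card_zmod, ← pow_add, hdim]
    congr 1
    omega
  -- The identity already holds for tensors; the equivariant linear map `tensorPoly` carries it to
  -- polynomials.
  have havg := congrArg (CliffordAverage.tensorPoly b)
    (CliffordAverage.average_codeTensor (m := m) hC hone hcard)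
  rw [CliffordAverage.average_apply, map_smul, map_smul, map_sum, map_sum] at havg
  simp_rw [← CliffordAverage.polyAction_tensorPoly, ← CliffordAverage.cwe_extendCode] at havg
  rw [finsum_eq_sum_of_fintype, havg]
  congr 1
  rw [finsum_eq_sum_of_fintype, Finset.sum_filter]
  exact Finset.sum_congr rfl fun C' _ => finsum_eq_if.symm
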